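/- Setting. In round $t=0,1,\dots,T-1$ of a stochastic linear bandit on the closed Euclidean unit ball $\mathcal A\subset\mathbb R^{d+1}$, a (possibly randomized) algorithm draws an action $a_t\in\mathcal A$ from a probability distribution depending on the past actions and rewards (a Markov kernel), and receives the reward $y_t=\langle a_t,\theta^\star\rangle+\xi_t$, where the $1$-sub-Gaussian noise $\xi_t$ is independent of the past and of $a_t$. Put $a^\star=\theta^\star/\|\theta^\star\|$, $r(a,a')=\langle\theta^\star,a\rangle-\langle\theta^\star,a'\rangle$ and $\operatorname{Reg}^{\theta^\star}(T)=\sum_{t<T} r(a^\star,a_t)$. Theorem. Let $d,T\in\mathbb N$ with $T\ge\max(d^2/2^8,\,2^6)$, and let $\Delta\ge 0$ with $\Delta^2=\frac{d}{2^8\sqrt T}$. For every hint $h\in\mathbb R^{d+1}$ with $\|h\|=1$ and every algorithm, there is a linear bandit instance with parameter $\theta^\star\in\mathbb R^{d+1}$ (and with standard Gaussian noise in every round) such that \[ \Big\|\theta^\star-\frac h2\Big\|\le\Delta,\qquad \|a^\star-h\|\le 4\Delta,\qquad r(a^\star,h)=\langle\theta^\star,a^\star-h\rangle\le 972\,\Delta^2=\frac{243}{64}\cdot\frac{d}{\sqrt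 T}=O\!\left(\frac{d}{\sqrt T}\right), \] and, on this same instance, the expected regret of the algorithm satisfies \[ \mathbb E\big[\operatorname{Reg}^{\theta^\star}(T)\big]\ \ge\ \frac{d\sqrt T}{512}. \] -/

import Mathlib

open MeasureTheory ProbabilityTheory
open scoped RealInnerProductSpace

noncomputable section

namespace LinBandit

/-- The action set: the closed Euclidean unit ball of `ℝⁿ`. -/
abbrev Action (n : ℕ) : Type :=
  ↥(Metric.closedBall (0 : EuclideanSpace ℝ (Fin n)) 1)

/-- What the learner has seen after `t` rounds: the actions played and the rewards received. -/
abbrev History (n t : ℕ) : Type := Fin t → Action n × ℝ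

/-- A stochastic linear bandit instance on the unit ball of `ℝⁿ`: the parameter vector, and for each
round the law of the noise, which is `1`-sub-Gaussian (in particular centered). -/
structure Instance (n : ℕ) where
  θ : EuclideanSpace ℝ (Fin n)
  noise : ℕ → Measure ℝ
  noise_prob : ∀ t, IsProbabilityMeasure (noise t)
  noise_subGaussian : ∀ t, HasSubgaussianMGF (fun x : ℝ => x) 1 (noise t)

/-- A (possibly randomized) algorithm: given the history of the first `t` rounds, a probability
distribution on the actions from which the action of the next round is drawn. -/
structure Algorithm (n : ℕ) where
  policy : (t : ℕ) → Kernel (History n t) (Action n)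
  policy_markov : ∀ t, IsMarkovKernel (policy t)

attribute [instance] Instance.noise_prob Algorithm.policy_markov

/-- One round: the action `a` and the noise value `ξ` extend a history by the pair
`(a, ⟪a, θ⟫ + ξ)`. -/
def extend {n : ℕ} (θ : EuclideanSpace ℝ (Fin n)) (t : ℕ)
    (p : (History n t × Action n) × ℝ) : History n (t + 1) :=
  Fin.snoc (α := fun _ => Action n × ℝ) p.1.1
    (p.1.2, ⟪(p.1.2 : EuclideanSpace ℝ (Fin n)), θ⟫ + p.2)

lemma measurable_extend {n : ℕ} (θ : EuclideanSpace ℝ (Fin n)) (t : ℕ) :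
    Measurable (extend θ t) := by
  refine measurable_pi_lambda _ fun i => ?_
  refine Fin.lastCases ?_ (fun j => ?_) i
  · simp only [extend, Fin.snoc_last]
    fun_prop
  · simp only [extend, Fin.snoc_castSucc]
    fun_prop

/-- The law of the history of the first `t` rounds when the algorithm `alg` runs on the
instance `B`: in each round the action is drawn from the policy given the past, and the noise is
independent of the past and of the action. -/
def historyLaw {n : ℕ} (alg : Algorithm n) (B : Instance n) : (t : ℕ) → Measure (History n t)
  | 0 => Measure.dirac Fin.elim0
  | t + 1 =>
      (((historyLaw alg B t) ⊗ₘ (alg.policy t)).prod (B.noise t)).map (extend B.θ t)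

/-- The law of the history is a probability measure, so no operation in its definition takes a
default value. -/
instance isProbabilityMeasure_historyLaw {n : ℕ} (alg : Algorithm n) (B : Instance n) (t : ℕ) :
    IsProbabilityMeasure (historyLaw alg B t) := by
  induction t with
  | zero => unfold historyLaw; infer_instance
  | succ t ih =>
    unfold historyLaw
    exact Measure.isProbabilityMeasure_map (measurable_extend B.θ t).aemeasurable

/-- The optimal action `a⋆ = θ / ‖θ‖` (for `θ ≠ 0`). -/
def Instance.optAction {n : ℕ} (B : Instance n) : EuclideanSpace ℝ (Fin n) :=
  ‖B.θ‖⁻¹ • B.θ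

/-- The instantaneous regret `r(a, a') = ⟪θ, a⟫ - ⟪θ, a'⟫` of `a'` with respect to `a`. -/
def Instance.instRegret {n : ℕ} (B : Instance n) (a a' : EuclideanSpace ℝ (Fin n)) : ℝ :=
  ⟪B.θ, a⟫ - ⟪B.θ, a'⟫

/-- The (pseudo-)regret `Reg(T) = ∑ t, r(a⋆, a_t)` along a history of `T` rounds. -/
def Instance.regret {n T : ℕ} (B : Instance n) (ω : History n T) : ℝ :=
  ∑ t : Fin T, B.instRegret B.optAction ((ω t).1 : EuclideanSpace ℝ (Fin n))

/-- The expected regret after `T` rounds of the algorithm `alg` on the instance `B`. -/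
def expectedRegret {n : ℕ} (alg : Algorithm n) (B : Instance n) (T : ℕ) : ℝ :=
  ∫ ω, B.regret ω ∂(historyLaw alg B T)

/-- The expected regret is the integral of an integrable (bounded, measurable) function. -/
lemma integrable_regret {n : ℕ} (alg : Algorithm n) (B : Instance n) (T : ℕ) :
    Integrable (fun ω : History n T => B.regret ω) (historyLaw alg B T) := by
  unfold Instance.regret Instance.instRegret
  refine integrable_finsetSum _ fun t _ => (integrable_const _).sub ?_
  refine Integrable.of_bound (C := ‖B.θ‖) ?_ (Filter.Eventually.of_forall fun ω => ?_)
  · exact Measurable.aestronglyMeasurable (by fun_prop)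
  · have h1 : ‖((ω t).1 : EuclideanSpace ℝ (Fin n))‖ ≤ 1 :=
      mem_closedBall_zero_iff.mp (ω t).1.2
    calc ‖⟪B.θ, ((ω t).1 : EuclideanSpace ℝ (Fin n))⟫‖
        ≤ ‖B.θ‖ * ‖((ω t).1 : EuclideanSpace ℝ (Fin n))‖ := norm_inner_le_norm _ _
      _ ≤ ‖B.θ‖ * 1 := by gcongr
      _ = ‖B.θ‖ := mul_one _

end LinBandit

end

/-!
Complete the hint `h = b 0` to an orthonormal basis and take the parameters
`θ = ρ • h + ∑ i, w i • b i.succ` with `w i = ± ε`. Since the actions lie in the unit ball,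
`⟪θ, a⟫` is at most `ρ` minus the sum over `i` of the directional costs
`ρ / 2 * ⟪a, b i.succ⟫ ^ 2 - w i * ⟪a, b i.succ⟫`, so the regret exceeds that of always playing `h`
by at least the directional costs along the history.

A directional cost is negative only if the actions lean to the correct side. Flipping the sign of
`w i` moves the law of the history by a squared Hellinger distance of at most a multiple of
`ε ^ 2` times the expected energy `∑ t, ⟪a_t, b i.succ⟫ ^ 2`. Hence, when `ε ^ 4 * T ≤ (ρ / 2) ^ 2`,
the quadratic part of the cost pays for all the information the actions gather, and the two
expected costs have a nonnegative sum. Averaging over the signs gives a parameter for which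
the algorithm is no better than always playing the hint.
-/

namespace LinBandit

section Gaussian

lemma hasSubgaussianMGF_gaussianReal (v : NNReal) :
    HasSubgaussianMGF (fun x : ℝ => x) v (gaussianReal 0 v) where
  integrable_exp_mul := integrable_exp_mul_gaussianReal
  mgf_le t := by simp [mgf_fun_id_gaussianReal]

lemma gaussianReal_add_eq_withDensity (m u : ℝ) {v : NNReal} (hv : v ≠ 0) :
    gaussianReal (m + u) v = (gaussianReal m v).withDensity
      fun x => ENNReal.ofReal (Real.exp ((u * (x - m) - u ^ 2 / 2) / v)) := by
  have hv' : (v : ℝ) ≠ 0 := NNReal.coe_ne_zero.mpr hv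
  rw [gaussianReal_of_var_ne_zero _ hv, gaussianReal_of_var_ne_zero _ hv,
    ← withDensity_mul _ (measurable_gaussianPDF _ _) (by fun_prop)]
  congr 1 with x
  rw [Pi.mul_apply, gaussianPDF, gaussianPDF, ← ENNReal.ofReal_mul (gaussianPDFReal_nonneg _ _ _),
    gaussianPDFReal, gaussianPDFReal, mul_assoc (_)⁻¹, ← Real.exp_add]
  congr 3
  field_simp
  ring

lemma lintegral_const_add_gaussianReal (u : ℝ) {f : ℝ → ENNReal} (hf : Measurable f) :
    ∫⁻ x, f (u + x) ∂(gaussianReal 0 1)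
      = ∫⁻ x, ENNReal.ofReal (Real.exp (u * x - u ^ 2 / 2)) * f x ∂(gaussianReal 0 1) := by
  rw [← lintegral_map hf (measurable_const_add u), gaussianReal_map_const_add,
    gaussianReal_add_eq_withDensity 0 u one_ne_zero,
    lintegral_withDensity_eq_lintegral_mul _ (by fun_prop) hf]
  simp

lemma integrable_exp_mul_sub_gaussianReal (m u c : ℝ) (v : NNReal) :
    Integrable (fun x => Real.exp (u * x - c)) (gaussianReal m v) := by
  simp only [Real.exp_sub]
  exact (integrable_exp_mul_gaussianReal u).div_const _

lemma integral_exp_mul_sub_gaussianReal (m u c : ℝ) (v : NNReal) :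
    ∫ x, Real.exp (u * x - c) ∂(gaussianReal m v) = Real.exp (m * u + v * u ^ 2 / 2 - c) := by
  have hmgf : ∫ x, Real.exp (u * x) ∂(gaussianReal m v) = Real.exp (m * u + v * u ^ 2 / 2) :=
    congrFun mgf_fun_id_gaussianReal u
  simp only [Real.exp_sub, integral_div, hmgf]

end Gaussian

section Hellinger

lemma two_mul_sqrt_mul_le_add {p q : ℝ} (hp : 0 ≤ p) (hq : 0 ≤ q) : 2 * √(p * q) ≤ p + q := by
  rw [Real.sqrt_mul hp]
  nlinarith [two_mul_le_add_sq √p √q, Real.sq_sqrt hp, Real.sq_sqrt hq]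

lemma mul_sub_le_hellinger {p q : ℝ} (hp : 0 ≤ p) (hq : 0 ≤ q) (x δ : ℝ) {c : ℝ} (hc : 0 < c) :
    δ * (p * x - q * x)
      ≤ c / 2 * (p * x ^ 2 + q * x ^ 2) + δ ^ 2 / c * (p + q - 2 * √(p * q)) := by
  obtain ⟨a, ha, rfl⟩ : ∃ a, 0 ≤ a ∧ a ^ 2 = p := ⟨√p, Real.sqrt_nonneg p, Real.sq_sqrt hp⟩
  obtain ⟨b, hb, rfl⟩ : ∃ b, 0 ≤ b ∧ b ^ 2 = q := ⟨√q, Real.sqrt_nonneg q, Real.sq_sqrt hq⟩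
  have hsqrt : √(a ^ 2 * b ^ 2) = a * b := by
    rw [← mul_pow, Real.sqrt_sq (mul_nonneg ha hb)]
  rw [hsqrt, ← sub_nonneg]
  calc 0 ≤ (c * x * (a + b) - 2 * δ * (a - b)) ^ 2 / (4 * c) + c / 4 * (x * (a - b)) ^ 2 := by
        positivity
    _ = _ := by
        field_simp
        ring

variable {Ω : Type*} [MeasurableSpace Ω] {μ : Measure Ω} {p q : Ω → ℝ}

lemma integrable_sqrt_mul (hp : Integrable p μ) (hq : Integrable q μ) (hp₀ : ∀ ω, 0 ≤ p ω)
    (hq₀ : ∀ ω, 0 ≤ q ω) : Integrable (fun ω => √(p ω * q ω)) μ := by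
  refine (hp.add hq).mono'
    (hp.aestronglyMeasurable.mul hq.aestronglyMeasurable).aemeasurable.sqrt.aestronglyMeasurable
    (.of_forall fun ω => ?_)
  rw [Real.norm_of_nonneg (Real.sqrt_nonneg _), Pi.add_apply]
  linarith [two_mul_sqrt_mul_le_add (hp₀ ω) (hq₀ ω), Real.sqrt_nonneg (p ω * q ω)]

lemma mul_integral_sub_integral_le_hellinger (hp : Integrable p μ) (hq : Integrable q μ)
    (hp₀ : ∀ ω, 0 ≤ p ω) (hq₀ : ∀ ω, 0 ≤ q ω) {X : Ω → ℝ}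
    (hpX : Integrable (fun ω => p ω * X ω) μ) (hqX : Integrable (fun ω => q ω * X ω) μ)
    (hpX2 : Integrable (fun ω => p ω * X ω ^ 2) μ) (hqX2 : Integrable (fun ω => q ω * X ω ^ 2) μ)
    (δ : ℝ) {c : ℝ} (hc : 0 < c) :
    δ * (∫ ω, p ω * X ω ∂μ - ∫ ω, q ω * X ω ∂μ)
      ≤ c / 2 * (∫ ω, p ω * X ω ^ 2 ∂μ + ∫ ω, q ω * X ω ^ 2 ∂μ)
        + δ ^ 2 / c * (∫ ω, p ω ∂μ + ∫ ω, q ω ∂μ - 2 * ∫ ω, √(p ω * q ω) ∂μ) := by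
  have hsqrt := (integrable_sqrt_mul hp hq hp₀ hq₀).const_mul 2
  have hmoment := (hpX2.fun_add hqX2).const_mul (c / 2)
  have hdist : Integrable (fun ω => δ ^ 2 / c * (p ω + q ω - 2 * √(p ω * q ω))) μ :=
    ((hp.fun_add hq).sub hsqrt).const_mul _
  calc δ * (∫ ω, p ω * X ω ∂μ - ∫ ω, q ω * X ω ∂μ)
      = ∫ ω, δ * (p ω * X ω - q ω * X ω) ∂μ := by
        rw [integral_const_mul, integral_sub hpX hqX]
    _ ≤ ∫ ω, (c / 2 * (p ω * X ω ^ 2 + q ω * X ω ^ 2)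
          + δ ^ 2 / c * (p ω + q ω - 2 * √(p ω * q ω))) ∂μ :=
        integral_mono ((hpX.sub hqX).const_mul δ) (hmoment.fun_add hdist) fun ω =>
          mul_sub_le_hellinger (hp₀ ω) (hq₀ ω) (X ω) δ hc
    _ = _ := by
        rw [integral_add hmoment hdist, integral_const_mul, integral_const_mul,
          integral_add hpX2 hqX2, integral_sub (hp.fun_add hq) hsqrt, integral_add hp hq,
          integral_const_mul]

end Hellinger

section Histories

variable {n t : ℕ}

/-- The history `ω` followed by one more round, with action `p.1` and reward `p.2`. It is `extend`
with the reward, rather than the noise, as its argument, hence independent of the parameter. -/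
def History.snoc (ω : History n t) (p : Action n × ℝ) : History n (t + 1) :=
  Fin.snoc (α := fun _ => Action n × ℝ) ω p

@[fun_prop]
lemma History.measurable_snoc {α : Type*} [MeasurableSpace α] {f : α → History n t}
    {g : α → Action n × ℝ} (hf : Measurable f) (hg : Measurable g) :
    Measurable fun x => History.snoc (f x) (g x) := by
  refine measurable_pi_lambda _ fun i => ?_
  refine Fin.lastCases ?_ (fun j => ?_) i
  · simpa only [History.snoc, Fin.snoc_last] using hg
  · simp only [History.snoc, Fin.snoc_castSucc]
    fun_prop

/-- The inner product with `v` of the action played in round `s` of the history `ω`. -/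
noncomputable def actionInner (v : EuclideanSpace ℝ (Fin n)) (ω : History n t) (s : Fin t) : ℝ :=
  ⟪(ω s).1.1, v⟫

/-- The energy of a history in the direction `v`: the sum of the squared inner products of its
actions with `v`, which is the Fisher information about the parameter in that direction. -/
noncomputable def energy (v : EuclideanSpace ℝ (Fin n)) (ω : History n t) : ℝ :=
  ∑ s, actionInner v ω s ^ 2

@[fun_prop]
lemma measurable_actionInner (v : EuclideanSpace ℝ (Fin n)) (s : Fin t) :
    Measurable fun ω : History n t => actionInner v ω s := by
  unfold actionInner
  fun_prop

@[fun_prop]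
lemma measurable_energy (v : EuclideanSpace ℝ (Fin n)) :
    Measurable (energy v : History n t → ℝ) := by
  unfold energy
  fun_prop

lemma norm_action_le_one (a : Action n) : ‖a.1‖ ≤ 1 :=
  mem_closedBall_zero_iff.mp a.2

lemma abs_actionInner_le (v : EuclideanSpace ℝ (Fin n)) (ω : History n t) (s : Fin t) :
    |actionInner v ω s| ≤ ‖v‖ :=
  (abs_real_inner_le_norm _ _).trans
    (mul_le_of_le_one_left (norm_nonneg v) (norm_action_le_one _))

lemma actionInner_sq_le (v : EuclideanSpace ℝ (Fin n)) (ω : History n t) (s : Fin t) :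
    actionInner v ω s ^ 2 ≤ ‖v‖ ^ 2 :=
  sq_le_sq.mpr ((abs_actionInner_le v ω s).trans (le_abs_self _))

lemma energy_nonneg (v : EuclideanSpace ℝ (Fin n)) (ω : History n t) : 0 ≤ energy v ω :=
  Finset.sum_nonneg fun _ _ => sq_nonneg _

lemma energy_smul (r : ℝ) (v : EuclideanSpace ℝ (Fin n)) (ω : History n t) :
    energy (r • v) ω = r ^ 2 * energy v ω := by
  simp only [energy, actionInner, inner_smul_right, mul_pow, Finset.mul_sum]

lemma energy_snoc (v : EuclideanSpace ℝ (Fin n)) (ω : History n t) (p : Action n × ℝ) :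
    energy v (History.snoc ω p) = energy v ω + ⟪p.1.1, v⟫ ^ 2 := by
  simp [energy, actionInner, History.snoc, Fin.sum_univ_castSucc]

lemma integrable_actionInner {μ : Measure (History n t)} [IsFiniteMeasure μ]
    (v : EuclideanSpace ℝ (Fin n)) (s : Fin t) : Integrable (fun ω => actionInner v ω s) μ :=
  .of_bound (by fun_prop) ‖v‖ (.of_forall fun ω => abs_actionInner_le v ω s)

lemma integrable_actionInner_sq {μ : Measure (History n t)} [IsFiniteMeasure μ]
    (v : EuclideanSpace ℝ (Fin n)) (s : Fin t) : Integrable (fun ω => actionInner v ω s ^ 2) μ :=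
  .of_bound (by fun_prop) (‖v‖ ^ 2) (.of_forall fun ω => by
    simpa using actionInner_sq_le v ω s)

lemma integrable_energy {μ : Measure (History n t)} [IsFiniteMeasure μ]
    (v : EuclideanSpace ℝ (Fin n)) : Integrable (energy v) μ :=
  integrable_finsetSum _ fun s _ => integrable_actionInner_sq v s

lemma integral_energy {μ : Measure (History n t)} [IsFiniteMeasure μ]
    (v : EuclideanSpace ℝ (Fin n)) :
    ∫ ω, energy v ω ∂μ = ∑ s, ∫ ω, actionInner v ω s ^ 2 ∂μ :=
  integral_finsetSum _ fun s _ => integrable_actionInner_sq v s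

end Histories

section ChangeOfMeasure

variable {n t : ℕ}

/-- The instance with parameter `θ` and standard Gaussian noise in every round. -/
noncomputable def gaussianInstance (θ : EuclideanSpace ℝ (Fin n)) : Instance n where
  θ := θ
  noise _ := gaussianReal 0 1
  noise_prob _ := inferInstance
  noise_subGaussian _ := hasSubgaussianMGF_gaussianReal 1

/-- The law of the history of the first `t` rounds under the parameter `θ` and standard Gaussian
noise. -/
noncomputable abbrev gaussianLaw (alg : Algorithm n) (θ : EuclideanSpace ℝ (Fin n)) (t : ℕ) :
    Measure (History n t) :=
  historyLaw alg (gaussianInstance θ) t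

lemma lintegral_gaussianLaw_succ (alg : Algorithm n) (θ : EuclideanSpace ℝ (Fin n))
    {f : History n (t + 1) → ENNReal} (hf : Measurable f) :
    ∫⁻ ω, f ω ∂(gaussianLaw alg θ (t + 1))
      = ∫⁻ ω, ∫⁻ a, ∫⁻ x, f (History.snoc ω (a, ⟪a.1, θ⟫ + x)) ∂(gaussianReal 0 1)
          ∂(alg.policy t ω) ∂(gaussianLaw alg θ t) := by
  have hfm : Measurable fun p => f (extend θ t p) := hf.comp (measurable_extend θ t)
  calc ∫⁻ ω, f ω ∂(gaussianLaw alg θ (t + 1))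
      = ∫⁻ p, f (extend θ t p) ∂((gaussianLaw alg θ t ⊗ₘ alg.policy t).prod (gaussianReal 0 1)) :=
        lintegral_map hf (measurable_extend θ t)
    _ = ∫⁻ q, ∫⁻ x, f (extend θ t (q, x)) ∂(gaussianReal 0 1)
          ∂(gaussianLaw alg θ t ⊗ₘ alg.policy t) := lintegral_prod _ hfm.aemeasurable
    _ = _ := Measure.lintegral_compProd hfm.lintegral_prod_right'

lemma lintegral_gaussianLaw_zero_le_of_le_snoc (alg : Algorithm n)
    {f : History n t → ENNReal} {g : History n (t + 1) → ENNReal} (hg : Measurable g)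
    (hfg : ∀ ω a, f ω ≤ ∫⁻ y, g (History.snoc ω (a, y)) ∂(gaussianReal 0 1)) :
    ∫⁻ ω, f ω ∂(gaussianLaw alg 0 t) ≤ ∫⁻ ω, g ω ∂(gaussianLaw alg 0 (t + 1)) := by
  simp only [lintegral_gaussianLaw_succ alg 0 hg, inner_zero_right, zero_add]
  refine lintegral_mono fun ω => ?_
  calc f ω = ∫⁻ _a, f ω ∂(alg.policy t ω) := by simp
    _ ≤ _ := lintegral_mono fun a => hfg ω a

/-- The likelihood ratio of the parameters `θ` and `0` under standard Gaussian noise. -/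
noncomputable def lik (θ : EuclideanSpace ℝ (Fin n)) (ω : History n t) : ℝ :=
  ∏ s, Real.exp (actionInner θ ω s * (ω s).2 - actionInner θ ω s ^ 2 / 2)

@[fun_prop]
lemma measurable_lik (θ : EuclideanSpace ℝ (Fin n)) :
    Measurable (lik θ : History n t → ℝ) := by
  unfold lik
  fun_prop

lemma lik_nonneg (θ : EuclideanSpace ℝ (Fin n)) (ω : History n t) : 0 ≤ lik θ ω :=
  Finset.prod_nonneg fun _ _ => (Real.exp_pos _).le

lemma lik_snoc (θ : EuclideanSpace ℝ (Fin n)) (ω : History n t) (a : Action n) (y : ℝ) :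
    lik θ (History.snoc ω (a, y)) = lik θ ω * Real.exp (⟪a.1, θ⟫ * y - ⟪a.1, θ⟫ ^ 2 / 2) := by
  simp [lik, actionInner, History.snoc, Fin.prod_univ_castSucc]

lemma lintegral_snoc_add_gaussianReal (θ : EuclideanSpace ℝ (Fin n)) (ω : History n t)
    (a : Action n) {f : History n (t + 1) → ENNReal} (hf : Measurable f) :
    ENNReal.ofReal (lik θ ω)
        * ∫⁻ x, f (History.snoc ω (a, ⟪a.1, θ⟫ + x)) ∂(gaussianReal 0 1)
      = ∫⁻ y, ENNReal.ofReal (lik θ (History.snoc ω (a, y))) * f (History.snoc ω (a, y))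
          ∂(gaussianReal 0 1) := by
  have hfa : Measurable fun y => f (History.snoc ω (a, y)) := by fun_prop
  rw [lintegral_const_add_gaussianReal _ hfa, ← lintegral_const_mul _ (by fun_prop)]
  simp only [lik_snoc, ENNReal.ofReal_mul (lik_nonneg θ ω), mul_assoc]

lemma gaussianLaw_eq_withDensity (alg : Algorithm n) (θ : EuclideanSpace ℝ (Fin n)) (t : ℕ) :
    gaussianLaw alg θ t
      = (gaussianLaw alg 0 t).withDensity fun ω => ENNReal.ofReal (lik θ ω) := by
  induction t with
  | zero => simp [historyLaw, lik]
  | succ t ih =>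
    refine Measure.ext_of_lintegral _ fun f hf => ?_
    have hround : Measurable fun p : History n t × Action n =>
        ∫⁻ x, f (History.snoc p.1 (p.2, ⟪p.2.1, θ⟫ + x)) ∂(gaussianReal 0 1) :=
      Measurable.lintegral_prod_right' (ν := gaussianReal 0 1)
        (f := fun p : (History n t × Action n) × ℝ =>
          f (History.snoc p.1.1 (p.1.2, ⟪p.1.2.1, θ⟫ + p.2))) (by fun_prop)
    rw [lintegral_withDensity_eq_lintegral_mul _ (by fun_prop) hf,
      lintegral_gaussianLaw_succ alg θ hf, lintegral_gaussianLaw_succ alg 0 (by fun_prop), ih,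
      lintegral_withDensity_eq_lintegral_mul _ (by fun_prop)
        hround.lintegral_kernel_prod_right']
    refine lintegral_congr fun ω => ?_
    have hround_ω : Measurable fun a : Action n =>
        ∫⁻ x, f (History.snoc ω (a, ⟪a.1, θ⟫ + x)) ∂(gaussianReal 0 1) :=
      hround.comp measurable_prodMk_left
    simp only [Pi.mul_apply, ← lintegral_const_mul _ hround_ω,
      lintegral_snoc_add_gaussianReal θ ω _ hf, inner_zero_right, zero_add]

lemma integral_gaussianLaw_eq (alg : Algorithm n) (θ : EuclideanSpace ℝ (Fin n))
    (f : History n t → ℝ) :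
    ∫ ω, f ω ∂(gaussianLaw alg θ t) = ∫ ω, lik θ ω * f ω ∂(gaussianLaw alg 0 t) := by
  rw [gaussianLaw_eq_withDensity, integral_withDensity_eq_integral_toReal_smul (by fun_prop)
    (by simp)]
  simp [ENNReal.toReal_ofReal (lik_nonneg _ _)]

lemma integrable_gaussianLaw_iff (alg : Algorithm n) (θ : EuclideanSpace ℝ (Fin n))
    (f : History n t → ℝ) :
    Integrable f (gaussianLaw alg θ t)
      ↔ Integrable (fun ω => lik θ ω * f ω) (gaussianLaw alg 0 t) := by
  rw [gaussianLaw_eq_withDensity, integrable_withDensity_iff_integrable_smul' (by fun_prop)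
    (by simp)]
  simp [ENNReal.toReal_ofReal (lik_nonneg _ _)]

lemma integrable_lik (alg : Algorithm n) (θ : EuclideanSpace ℝ (Fin n)) :
    Integrable (lik θ : History n t → ℝ) (gaussianLaw alg 0 t) := by
  simpa using (integrable_gaussianLaw_iff alg θ fun _ => 1).mp (integrable_const 1)

lemma integral_lik (alg : Algorithm n) (θ : EuclideanSpace ℝ (Fin n)) :
    ∫ ω : History n t, lik θ ω ∂(gaussianLaw alg 0 t) = 1 := by
  simpa using (integral_gaussianLaw_eq alg θ fun _ : History n t => 1).symm

end ChangeOfMeasure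

section Affinity

variable {n t : ℕ}

/-- The Hellinger affinity (Bhattacharyya coefficient) of the laws of the history under the
parameters `θ` and `θ'`, computed with the law under the parameter `0` as dominating measure. -/
noncomputable def hellingerAffinity (alg : Algorithm n) (θ θ' : EuclideanSpace ℝ (Fin n)) (t : ℕ) :
    ℝ :=
  ∫ ω : History n t, √(lik θ ω * lik θ' ω) ∂(gaussianLaw alg 0 t)

lemma sqrt_lik_mul_lik_snoc (θ θ' : EuclideanSpace ℝ (Fin n)) (ω : History n t) (a : Action n)
    (y : ℝ) :
    √(lik θ (History.snoc ω (a, y)) * lik θ' (History.snoc ω (a, y)))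
      = √(lik θ ω * lik θ' ω) * Real.exp ((⟪a.1, θ⟫ + ⟪a.1, θ'⟫) / 2 * y
          - (⟪a.1, θ⟫ ^ 2 + ⟪a.1, θ'⟫ ^ 2) / 4) := by
  rw [lik_snoc, lik_snoc, mul_mul_mul_comm,
    Real.sqrt_mul (mul_nonneg (lik_nonneg θ ω) (lik_nonneg θ' ω)), ← Real.exp_add, ← Real.exp_half]
  congr 2
  ring

lemma integrable_sqrt_lik_mul_lik_snoc (θ θ' : EuclideanSpace ℝ (Fin n)) (ω : History n t)
    (a : Action n) :
    Integrable (fun y => √(lik θ (History.snoc ω (a, y)) * lik θ' (History.snoc ω (a, y))))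
      (gaussianReal 0 1) := by
  simp only [sqrt_lik_mul_lik_snoc]
  exact (integrable_exp_mul_sub_gaussianReal _ _ _ _).const_mul _

lemma integral_sqrt_lik_mul_lik_snoc (θ θ' : EuclideanSpace ℝ (Fin n)) (ω : History n t)
    (a : Action n) :
    ∫ y, √(lik θ (History.snoc ω (a, y)) * lik θ' (History.snoc ω (a, y))) ∂(gaussianReal 0 1)
      = √(lik θ ω * lik θ' ω) * Real.exp (-⟪a.1, θ - θ'⟫ ^ 2 / 8) := by
  simp only [sqrt_lik_mul_lik_snoc, integral_const_mul, integral_exp_mul_sub_gaussianReal,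
    inner_sub_right]
  congr 2
  push_cast
  ring

lemma integrable_lik_snoc (θ : EuclideanSpace ℝ (Fin n)) (ω : History n t) (a : Action n) :
    Integrable (fun y => lik θ (History.snoc ω (a, y))) (gaussianReal 0 1) := by
  simpa [Real.sqrt_mul_self (lik_nonneg _ _)] using integrable_sqrt_lik_mul_lik_snoc θ θ ω a

lemma integral_lik_snoc (θ : EuclideanSpace ℝ (Fin n)) (ω : History n t) (a : Action n) :
    ∫ y, lik θ (History.snoc ω (a, y)) ∂(gaussianReal 0 1) = lik θ ω := by
  simpa [Real.sqrt_mul_self (lik_nonneg _ _)] using integral_sqrt_lik_mul_lik_snoc θ θ ω a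

/-- A submartingale under the parameter `0` which starts at `1`: the energy term compensates for
the decrease of the Hellinger affinity. -/
noncomputable def affinityPotential (θ θ' : EuclideanSpace ℝ (Fin n)) (ω : History n t) : ℝ :=
  √(lik θ ω * lik θ' ω) + 1 / 16 * (lik θ ω + lik θ' ω) * energy (θ - θ') ω

lemma affinityPotential_nonneg (θ θ' : EuclideanSpace ℝ (Fin n)) (ω : History n t) :
    0 ≤ affinityPotential θ θ' ω := by
  have hlik := add_nonneg (lik_nonneg θ ω) (lik_nonneg θ' ω)
  have henergy := energy_nonneg (θ - θ') ω
  unfold affinityPotential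
  positivity

lemma affinityPotential_snoc (θ θ' : EuclideanSpace ℝ (Fin n)) (ω : History n t) (a : Action n)
    (y : ℝ) :
    affinityPotential θ θ' (History.snoc ω (a, y))
      = √(lik θ (History.snoc ω (a, y)) * lik θ' (History.snoc ω (a, y)))
        + 1 / 16 * (energy (θ - θ') ω + ⟪a.1, θ - θ'⟫ ^ 2)
          * (lik θ (History.snoc ω (a, y)) + lik θ' (History.snoc ω (a, y))) := by
  rw [affinityPotential, energy_snoc]
  ring

lemma integrable_affinityPotential_snoc (θ θ' : EuclideanSpace ℝ (Fin n)) (ω : History n t)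
    (a : Action n) :
    Integrable (fun y => affinityPotential θ θ' (History.snoc ω (a, y))) (gaussianReal 0 1) := by
  simp only [affinityPotential_snoc]
  exact (integrable_sqrt_lik_mul_lik_snoc θ θ' ω a).fun_add
    (((integrable_lik_snoc θ ω a).fun_add (integrable_lik_snoc θ' ω a)).const_mul _)

lemma affinityPotential_le_integral_snoc (θ θ' : EuclideanSpace ℝ (Fin n)) (ω : History n t)
    (a : Action n) :
    affinityPotential θ θ' ω
      ≤ ∫ y, affinityPotential θ θ' (History.snoc ω (a, y)) ∂(gaussianReal 0 1) := by
  have hlik := (integrable_lik_snoc θ ω a).fun_add (integrable_lik_snoc θ' ω a)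
  have hstep : ∫ y, affinityPotential θ θ' (History.snoc ω (a, y)) ∂(gaussianReal 0 1)
      = √(lik θ ω * lik θ' ω) * Real.exp (-⟪a.1, θ - θ'⟫ ^ 2 / 8)
        + 1 / 16 * (energy (θ - θ') ω + ⟪a.1, θ - θ'⟫ ^ 2) * (lik θ ω + lik θ' ω) := by
    simp only [affinityPotential_snoc]
    rw [integral_add (integrable_sqrt_lik_mul_lik_snoc θ θ' ω a) (hlik.const_mul _),
      integral_sqrt_lik_mul_lik_snoc, integral_const_mul,
      integral_add (integrable_lik_snoc θ ω a) (integrable_lik_snoc θ' ω a), integral_lik_snoc,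
      integral_lik_snoc]
  have hexp := mul_le_mul_of_nonneg_left (Real.add_one_le_exp (-⟪a.1, θ - θ'⟫ ^ 2 / 8))
    (Real.sqrt_nonneg (lik θ ω * lik θ' ω))
  have hamgm := mul_le_mul_of_nonneg_right
    (two_mul_sqrt_mul_le_add (lik_nonneg θ ω) (lik_nonneg θ' ω)) (sq_nonneg ⟪a.1, θ - θ'⟫)
  rw [hstep, affinityPotential]
  linarith

lemma one_le_lintegral_affinityPotential (alg : Algorithm n) (θ θ' : EuclideanSpace ℝ (Fin n))
    (t : ℕ) :
    1 ≤ ∫⁻ ω : History n t, ENNReal.ofReal (affinityPotential θ θ' ω) ∂(gaussianLaw alg 0 t) := by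
  induction t with
  | zero => simp [historyLaw, affinityPotential, lik, energy]
  | succ t ih =>
    have hmeas : Measurable (affinityPotential θ θ' : History n (t + 1) → ℝ) := by
      unfold affinityPotential
      fun_prop
    refine ih.trans (lintegral_gaussianLaw_zero_le_of_le_snoc alg (by fun_prop) fun ω a => ?_)
    rw [← ofReal_integral_eq_lintegral_ofReal (integrable_affinityPotential_snoc θ θ' ω a)
      (.of_forall fun _ => affinityPotential_nonneg _ _ _)]
    exact ENNReal.ofReal_le_ofReal (affinityPotential_le_integral_snoc θ θ' ω a)

lemma one_sub_hellingerAffinity_le (alg : Algorithm n) (θ θ' : EuclideanSpace ℝ (Fin n)) (t : ℕ) :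
    1 - hellingerAffinity alg θ θ' t
      ≤ 1 / 16 * (∫ ω, energy (θ - θ') ω ∂(gaussianLaw alg θ t)
        + ∫ ω, energy (θ - θ') ω ∂(gaussianLaw alg θ' t)) := by
  have hsqrt : Integrable (fun ω : History n t => √(lik θ ω * lik θ' ω)) (gaussianLaw alg 0 t) :=
    integrable_sqrt_mul (integrable_lik alg θ) (integrable_lik alg θ') (lik_nonneg θ)
      (lik_nonneg θ')
  have hE := (integrable_gaussianLaw_iff alg θ (t := t) _).mp (integrable_energy (θ - θ'))
  have hE' := (integrable_gaussianLaw_iff alg θ' (t := t) _).mp (integrable_energy (θ - θ'))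
  have hEE := (hE.fun_add hE').const_mul (1 / 16)
  have hpot : (affinityPotential θ θ' : History n t → ℝ) = fun ω => √(lik θ ω * lik θ' ω)
      + 1 / 16 * (lik θ ω * energy (θ - θ') ω + lik θ' ω * energy (θ - θ') ω) := by
    funext ω
    rw [affinityPotential]
    ring
  have hone : 1 ≤ ∫ ω : History n t, affinityPotential θ θ' ω ∂(gaussianLaw alg 0 t) := by
    rw [← ENNReal.one_le_ofReal, ofReal_integral_eq_lintegral_ofReal (hpot ▸ hsqrt.fun_add hEE)
      (.of_forall (affinityPotential_nonneg θ θ'))]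
    exact one_le_lintegral_affinityPotential alg θ θ' t
  rw [hpot, integral_add hsqrt hEE, integral_const_mul, integral_add hE hE',
    ← integral_gaussianLaw_eq, ← integral_gaussianLaw_eq] at hone
  rw [hellingerAffinity]
  linarith

lemma mul_integral_actionInner_sub_le (alg : Algorithm n) (θ θ' e : EuclideanSpace ℝ (Fin n))
    (s : Fin t) (δ : ℝ) {c : ℝ} (hc : 0 < c) :
    δ * (∫ ω, actionInner e ω s ∂(gaussianLaw alg θ t)
        - ∫ ω, actionInner e ω s ∂(gaussianLaw alg θ' t))
      ≤ c / 2 * (∫ ω, actionInner e ω s ^ 2 ∂(gaussianLaw alg θ t)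
          + ∫ ω, actionInner e ω s ^ 2 ∂(gaussianLaw alg θ' t))
        + 2 * δ ^ 2 / c * (1 - hellingerAffinity alg θ θ' t) := by
  have h := mul_integral_sub_integral_le_hellinger (integrable_lik alg θ) (integrable_lik alg θ')
    (lik_nonneg θ) (lik_nonneg θ')
    ((integrable_gaussianLaw_iff alg θ _).mp (integrable_actionInner e s))
    ((integrable_gaussianLaw_iff alg θ' _).mp (integrable_actionInner e s))
    ((integrable_gaussianLaw_iff alg θ _).mp (integrable_actionInner_sq e s))
    ((integrable_gaussianLaw_iff alg θ' _).mp (integrable_actionInner_sq e s)) δ hc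
  rw [integral_lik, integral_lik] at h
  simp only [← integral_gaussianLaw_eq] at h
  refine h.trans (le_of_eq ?_)
  rw [hellingerAffinity]
  ring

/-- The part of the regret that is incurred in the direction `e`: leaning towards `e` gains at rate
`δ` and costs quadratically. -/
noncomputable def directionalCost (c δ : ℝ) (e : EuclideanSpace ℝ (Fin n)) (ω : History n t) : ℝ :=
  ∑ s, (c * actionInner e ω s ^ 2 - δ * actionInner e ω s)

lemma integrable_directionalCost {μ : Measure (History n t)} [IsFiniteMeasure μ] (c δ : ℝ)
    (e : EuclideanSpace ℝ (Fin n)) : Integrable (directionalCost c δ e) μ :=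
  integrable_finsetSum _ fun s _ =>
    ((integrable_actionInner_sq e s).const_mul c).sub ((integrable_actionInner e s).const_mul δ)

lemma integral_directionalCost {μ : Measure (History n t)} [IsFiniteMeasure μ] (c δ : ℝ)
    (e : EuclideanSpace ℝ (Fin n)) :
    ∫ ω, directionalCost c δ e ω ∂μ
      = c * ∫ ω, energy e ω ∂μ - δ * ∑ s, ∫ ω, actionInner e ω s ∂μ := by
  have hsq s := (integrable_actionInner_sq (μ := μ) e s).const_mul c
  have hlin s := (integrable_actionInner (μ := μ) e s).const_mul δ
  have hdiff s : Integrable (fun ω => c * actionInner e ω s ^ 2 - δ * actionInner e ω s) μ :=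
    (hsq s).sub (hlin s)
  simp only [directionalCost]
  rw [integral_finsetSum _ fun s _ => hdiff s, integral_energy, Finset.mul_sum, Finset.mul_sum,
    ← Finset.sum_sub_distrib]
  simp only [integral_sub (hsq _) (hlin _), integral_const_mul]

lemma integral_directionalCost_add_nonneg (alg : Algorithm n)
    {θ θ' e : EuclideanSpace ℝ (Fin n)} {c δ : ℝ} (hc : 0 < c) (hδ : δ ^ 4 * t ≤ c ^ 2)
    (he : θ - θ' = (2 * δ) • e) :
    0 ≤ ∫ ω : History n t, directionalCost c δ e ω ∂(gaussianLaw alg θ t)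
      + ∫ ω : History n t, directionalCost c (-δ) e ω ∂(gaussianLaw alg θ' t) := by
  have hsum := Finset.sum_le_sum fun s (_ : s ∈ Finset.univ) =>
    mul_integral_actionInner_sub_le (t := t) alg θ θ' e s δ hc
  have haff := one_sub_hellingerAffinity_le alg θ θ' t
  simp only [he, energy_smul, integral_const_mul, ← mul_add] at haff
  rw [← Finset.mul_sum, Finset.sum_sub_distrib, Finset.sum_add_distrib, ← Finset.mul_sum,
    Finset.sum_add_distrib, ← integral_energy, ← integral_energy, Finset.sum_const,
    Finset.card_univ, Fintype.card_fin, nsmul_eq_mul] at hsum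
  rw [integral_directionalCost, integral_directionalCost]
  set V := ∫ ω : History n t, energy e ω ∂(gaussianLaw alg θ t)
  set V' := ∫ ω : History n t, energy e ω ∂(gaussianLaw alg θ' t)
  have hVV : 0 ≤ V + V' := add_nonneg (integral_nonneg (energy_nonneg e))
    (integral_nonneg (energy_nonneg e))
  have hinfo : t * (2 * δ ^ 2 / c * (1 - hellingerAffinity alg θ θ' t)) ≤ c / 2 * (V + V') :=
    calc t * (2 * δ ^ 2 / c * (1 - hellingerAffinity alg θ θ' t))
        ≤ t * (2 * δ ^ 2 / c * (1 / 16 * ((2 * δ) ^ 2 * (V + V')))) := by gcongr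
      _ = δ ^ 4 * t / (2 * c) * (V + V') := by
          field_simp
          ring
      _ ≤ c ^ 2 / (2 * c) * (V + V') := by gcongr
      _ = c / 2 * (V + V') := by
          field_simp
  linarith

end Affinity

section Geometry

lemma sqrt_sq_add_sub_le {ρ x : ℝ} (hρ : 0 < ρ) (hx : 0 ≤ x) : √(ρ ^ 2 + x) - ρ ≤ x / (2 * ρ) := by
  refine sub_le_iff_le_add.mpr (Real.sqrt_le_iff.mpr ⟨by positivity, ?_⟩)
  have hsq : (x / (2 * ρ) + ρ) ^ 2 = ρ ^ 2 + x + (x / (2 * ρ)) ^ 2 := by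
    field_simp
    ring
  linarith [sq_nonneg (x / (2 * ρ))]

lemma le_sqrt_sq_add_sub {ρ x : ℝ} (hρ : 0 < ρ) (hx : 0 ≤ x) (hxρ : x ≤ 8 * ρ ^ 2) :
    x / (4 * ρ) ≤ √(ρ ^ 2 + x) - ρ := by
  refine le_sub_iff_add_le.mpr (Real.le_sqrt_of_sq_le ?_)
  have hsq : ρ ^ 2 + x - (x / (4 * ρ) + ρ) ^ 2 = x * (8 * ρ ^ 2 - x) / (16 * ρ ^ 2) := by
    field_simp
    ring
  have hnonneg : 0 ≤ x * (8 * ρ ^ 2 - x) / (16 * ρ ^ 2) :=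
    div_nonneg (mul_nonneg hx (sub_nonneg.mpr hxρ)) (by positivity)
  linarith

variable {E : Type*} [NormedAddCommGroup E] [InnerProductSpace ℝ E]

lemma norm_normalize_sub_le {h x : E} (hh : ‖h‖ = 1) (hx : 0 < ⟪h, x⟫) :
    ‖‖x‖⁻¹ • x - h‖ ≤ ‖x - ⟪h, x⟫ • h‖ / ⟪h, x⟫ := by
  have hle : ⟪h, x⟫ ≤ ‖x‖ := by simpa [hh] using real_inner_le_norm h x
  have hleft : ‖‖x‖⁻¹ • x - h‖ ^ 2 = 2 - 2 * (⟪h, x⟫ / ‖x‖) := by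
    rw [norm_sub_sq_real, norm_smul, norm_inv, norm_norm, inv_mul_cancel₀ (hx.trans_le hle).ne',
      real_inner_smul_left, real_inner_comm, hh]
    ring
  have hright : ‖x - ⟪h, x⟫ • h‖ ^ 2 = ‖x‖ ^ 2 - ⟪h, x⟫ ^ 2 := by
    rw [norm_sub_sq_real, norm_smul, real_inner_smul_right, real_inner_comm h x, hh,
      Real.norm_of_nonneg hx.le]
    ring
  refine (pow_le_pow_iff_left₀ (norm_nonneg _) (by positivity) two_ne_zero).mp ?_
  rw [div_pow, hleft, hright]
  generalize ⟪h, x⟫ = ρ at *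
  generalize ‖x‖ = N at *
  have hN : 0 < N := hx.trans_le hle
  have hfactor : (N ^ 2 - ρ ^ 2) / ρ ^ 2 - (2 - 2 * (ρ / N))
      = (N - ρ) ^ 2 * (N + 2 * ρ) / (ρ ^ 2 * N) := by
    field_simp
    ring
  have hnonneg : 0 ≤ (N - ρ) ^ 2 * (N + 2 * ρ) / (ρ ^ 2 * N) := by positivity
  linarith

variable {d : ℕ} (b : OrthonormalBasis (Fin (d + 1)) ℝ E) (ρ : ℝ) (w : Fin d → ℝ)

/-- The vector `ρ • b 0 + ∑ i, w i • b i.succ`: the first basis vector plays the role of the hint,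
and `w` is a perturbation orthogonal to it. -/
noncomputable def perturbedHint : E :=
  ρ • b 0 + ∑ i, w i • b i.succ

lemma inner_perturbedHint (x : E) :
    ⟪x, perturbedHint b ρ w⟫ = ρ * ⟪x, b 0⟫ + ∑ i, w i * ⟪x, b i.succ⟫ := by
  simp [perturbedHint, inner_add_right, inner_sum, inner_smul_right]

lemma inner_zero_perturbedHint : ⟪b 0, perturbedHint b ρ w⟫ = ρ := by
  simp [inner_perturbedHint, b.inner_eq_ite, (Fin.succ_ne_zero _).symm]

lemma inner_succ_perturbedHint (i : Fin d) : ⟪b i.succ, perturbedHint b ρ w⟫ = w i := by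
  simp [inner_perturbedHint, b.inner_eq_ite, Fin.succ_ne_zero]

lemma norm_sq_eq_inner_zero_add_sum_succ (x : E) :
    ‖x‖ ^ 2 = ⟪x, b 0⟫ ^ 2 + ∑ i : Fin d, ⟪x, b i.succ⟫ ^ 2 := by
  rw [← b.sum_sq_norm_inner_left x, Fin.sum_univ_succ]
  simp

lemma norm_perturbedHint : ‖perturbedHint b ρ w‖ = √(ρ ^ 2 + ∑ i, w i ^ 2) := by
  rw [← Real.sqrt_sq (norm_nonneg _), norm_sq_eq_inner_zero_add_sum_succ b]
  simp only [real_inner_comm (b _) (perturbedHint b ρ w), inner_zero_perturbedHint,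
    inner_succ_perturbedHint]

lemma norm_perturbedHint_sub : ‖perturbedHint b ρ w - ρ • b 0‖ = √(∑ i, w i ^ 2) := by
  have h := norm_perturbedHint b 0 w
  rwa [perturbedHint, zero_smul, zero_add, zero_pow two_ne_zero, zero_add,
    ← add_sub_cancel_left (ρ • b 0) (∑ i, _)] at h

lemma perturbedHint_sub_update_neg (i : Fin d) :
    perturbedHint b ρ w - perturbedHint b ρ (Function.update w i (-w i))
      = (2 * w i) • b i.succ := by
  rw [perturbedHint, perturbedHint, add_sub_add_left_eq_sub, ← Finset.sum_sub_distrib,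
    Finset.sum_eq_single i (fun j _ hj => by simp [hj]) (by simp), ← sub_smul,
    Function.update_self]
  congr 1
  ring

variable {ρ}

lemma inner_perturbedHint_le (hρ : 0 ≤ ρ) {x : E} (hx : ‖x‖ ≤ 1) :
    ⟪x, perturbedHint b ρ w⟫
      ≤ ρ - ∑ i, (ρ / 2 * ⟪x, b i.succ⟫ ^ 2 - w i * ⟪x, b i.succ⟫) := by
  have hnorm := norm_sq_eq_inner_zero_add_sum_succ b x
  have hzero : ⟪x, b 0⟫ ≤ 1 - (∑ i : Fin d, ⟪x, b i.succ⟫ ^ 2) / 2 := by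
    nlinarith [sq_nonneg (⟪x, b 0⟫ - 1), norm_nonneg x]
  rw [inner_perturbedHint, Finset.sum_sub_distrib, ← Finset.mul_sum]
  linarith [mul_le_mul_of_nonneg_left hzero hρ]

end Geometry

section HardInstance

lemma Instance.inner_optAction {n : ℕ} (B : Instance n) : ⟪B.θ, B.optAction⟫ = ‖B.θ‖ := by
  rw [optAction, real_inner_smul_right, real_inner_self_eq_norm_mul_norm, ← mul_assoc,
    inv_mul_mul_self]

variable {d T : ℕ} (b : OrthonormalBasis (Fin (d + 1)) ℝ (EuclideanSpace ℝ (Fin (d + 1))))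
  {ρ : ℝ} (w : Fin d → ℝ)

lemma add_sum_directionalCost_le_regret (hρ : 0 ≤ ρ) (ω : History (d + 1) T) :
    T * (‖perturbedHint b ρ w‖ - ρ) + ∑ i, directionalCost (ρ / 2) (w i) (b i.succ) ω
      ≤ (gaussianInstance (perturbedHint b ρ w)).regret ω := by
  have hT : T * (‖perturbedHint b ρ w‖ - ρ) = ∑ _s : Fin T, (‖perturbedHint b ρ w‖ - ρ) := by
    simp [mul_sub]
  simp only [Instance.regret, Instance.instRegret, Instance.inner_optAction, directionalCost]
  rw [hT, Finset.sum_comm, ← Finset.sum_add_distrib]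
  refine Finset.sum_le_sum fun s _ => ?_
  have hs := inner_perturbedHint_le b w hρ (norm_action_le_one (ω s).1)
  rw [real_inner_comm] at hs
  simp only [gaussianInstance, actionInner]
  linarith

lemma add_sum_integral_directionalCost_le_expectedRegret (alg : Algorithm (d + 1)) (T : ℕ)
    (hρ : 0 ≤ ρ) :
    T * (‖perturbedHint b ρ w‖ - ρ)
        + ∑ i, ∫ ω : History (d + 1) T, directionalCost (ρ / 2) (w i) (b i.succ) ω
          ∂(gaussianLaw alg (perturbedHint b ρ w) T)
      ≤ expectedRegret alg (gaussianInstance (perturbedHint b ρ w)) T := by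
  have hcost i := integrable_directionalCost (μ := gaussianLaw alg (perturbedHint b ρ w) T)
    (ρ / 2) (w i) (b i.succ)
  have hsum := integrable_finsetSum Finset.univ fun i _ => hcost i
  have h := integral_mono ((integrable_const _).fun_add hsum) (integrable_regret alg _ T)
    (add_sum_directionalCost_le_regret b w hρ)
  rw [integral_add (integrable_const _) hsum, integral_finsetSum _ fun i _ => hcost i] at h
  simpa [expectedRegret] using h

lemma exists_signs_sum_nonneg {ι : Type*} [Fintype ι] [DecidableEq ι] (F : ι → (ι → ℤˣ) → ℝ)
    (hF : ∀ i σ, 0 ≤ F i σ + F i (Function.update σ i (-σ i))) : ∃ σ, 0 ≤ ∑ i, F i σ := by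
  have hcoord i : 0 ≤ ∑ σ, F i σ := by
    have hinv : Function.Involutive fun σ : ι → ℤˣ => Function.update σ i (-σ i) := fun σ => by
      simp
    have hflip : ∑ σ, F i (Function.update σ i (-σ i)) = ∑ σ, F i σ :=
      Equiv.sum_comp hinv.toPerm (F i)
    have hpair := Finset.sum_nonneg fun σ (_ : σ ∈ Finset.univ) => hF i σ
    rw [Finset.sum_add_distrib, hflip] at hpair
    linarith
  have htotal : ∑ _σ : ι → ℤˣ, (0 : ℝ) ≤ ∑ σ, ∑ i, F i σ := by
    rw [Finset.sum_comm, Finset.sum_const_zero]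
    exact Finset.sum_nonneg fun i _ => hcoord i
  obtain ⟨σ, -, hσ⟩ := Finset.exists_le_of_sum_le Finset.univ_nonempty htotal
  exact ⟨σ, hσ⟩

lemma exists_signs_le_expectedRegret (alg : Algorithm (d + 1)) {ε : ℝ} (hρ : 0 < ρ)
    (hε : ε ^ 4 * T ≤ (ρ / 2) ^ 2) :
    ∃ w : Fin d → ℝ, (∀ i, w i ^ 2 = ε ^ 2) ∧ T * (‖perturbedHint b ρ w‖ - ρ)
      ≤ expectedRegret alg (gaussianInstance (perturbedHint b ρ w)) T := by
  let w (σ : Fin d → ℤˣ) (i : Fin d) : ℝ := ((σ i : ℤ) : ℝ) * ε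
  have hw σ i : w σ i ^ 2 = ε ^ 2 := by
    rcases Int.units_eq_one_or (σ i) with h | h <;> simp [w, h]
  have hflip σ i : w (Function.update σ i (-σ i)) = Function.update (w σ) i (-w σ i) := by
    funext j
    rcases eq_or_ne j i with rfl | hj <;> simp [w, *]
  obtain ⟨σ, hσ⟩ := exists_signs_sum_nonneg
    (fun i σ => ∫ ω : History (d + 1) T, directionalCost (ρ / 2) (w σ i) (b i.succ) ω
      ∂(gaussianLaw alg (perturbedHint b ρ (w σ)) T)) fun i σ => by
    have hδ : w σ i ^ 4 * T ≤ (ρ / 2) ^ 2 := by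
      rwa [show w σ i ^ 4 = (w σ i ^ 2) ^ 2 by ring, hw, ← pow_mul]
    simpa only [hflip, Function.update_self] using
      integral_directionalCost_add_nonneg alg (half_pos hρ) hδ
        (perturbedHint_sub_update_neg b ρ (w σ) i)
  exact ⟨w σ, hw σ, by
    linarith [add_sum_integral_directionalCost_le_expectedRegret b (w σ) alg T hρ.le]⟩

lemma exists_perturbation_le_expectedRegret (alg : Algorithm (d + 1)) {Δ : ℝ} (hT : 0 < T)
    (hρ : 0 < ρ) (hΔ : 2 * √(T : ℝ) * Δ ^ 2 ≤ ρ * d) :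
    ∃ w : Fin d → ℝ, ∑ i, w i ^ 2 = Δ ^ 2 ∧ T * (‖perturbedHint b ρ w‖ - ρ)
      ≤ expectedRegret alg (gaussianInstance (perturbedHint b ρ w)) T := by
  have hε : √(Δ ^ 2 / d) ^ 2 = Δ ^ 2 / d := Real.sq_sqrt (by positivity)
  have hratio : √(T : ℝ) * Δ ^ 2 / d ≤ ρ / 2 :=
    div_le_of_le_mul₀ d.cast_nonneg (half_pos hρ).le (by linarith)
  have hε_le : √(Δ ^ 2 / d) ^ 4 * T ≤ (ρ / 2) ^ 2 :=
    calc √(Δ ^ 2 / d) ^ 4 * T = (√(T : ℝ) * Δ ^ 2 / d) ^ 2 := by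
          rw [show √(Δ ^ 2 / d) ^ 4 = (√(Δ ^ 2 / d) ^ 2) ^ 2 by ring, hε, mul_div_assoc, mul_pow,
            Real.sq_sqrt T.cast_nonneg, mul_comm]
      _ ≤ (ρ / 2) ^ 2 := by
          gcongr
  obtain ⟨w, hw, hregret⟩ := exists_signs_le_expectedRegret b alg hρ hε_le
  refine ⟨w, ?_, hregret⟩
  have hΔ_zero (hd : (d : ℝ) = 0) : Δ ^ 2 = 0 := by
    have hsqrtT : 0 < √(T : ℝ) := Real.sqrt_pos.mpr (Nat.cast_pos.mpr hT)
    rw [hd, mul_zero] at hΔ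
    nlinarith [sq_nonneg Δ]
  simp only [hw, hε, Finset.sum_const, Finset.card_univ, Fintype.card_fin, nsmul_eq_mul,
    mul_div_cancel_of_imp' hΔ_zero]

lemma instRegret_optAction_gaussianInstance_perturbedHint :
    (gaussianInstance (perturbedHint b ρ w)).instRegret
      (gaussianInstance (perturbedHint b ρ w)).optAction (b 0) = ‖perturbedHint b ρ w‖ - ρ := by
  rw [Instance.instRegret, Instance.inner_optAction, real_inner_comm]
  exact congrArg _ (inner_zero_perturbedHint b ρ w)

lemma norm_optAction_gaussianInstance_perturbedHint_sub_le (hρ : 0 < ρ) :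
    ‖(gaussianInstance (perturbedHint b ρ w)).optAction - b 0‖ ≤ √(∑ i, w i ^ 2) / ρ := by
  have hinner := inner_zero_perturbedHint b ρ w
  have hopt := norm_normalize_sub_le (b.norm_eq_one 0) (hinner.symm ▸ hρ)
  rwa [hinner, norm_perturbedHint_sub] at hopt

lemma exists_orthonormalBasis_zero_eq {h : EuclideanSpace ℝ (Fin (d + 1))} (hh : ‖h‖ = 1) :
    ∃ b : OrthonormalBasis (Fin (d + 1)) ℝ (EuclideanSpace ℝ (Fin (d + 1))), b 0 = h := by
  have horth : Orthonormal ℝ (({0} : Set (Fin (d + 1))).domRestrict fun _ => h) :=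
    ⟨fun _ => hh, fun i j hij => absurd (Subsingleton.elim i j) hij⟩
  obtain ⟨b, hb⟩ := horth.exists_orthonormalBasis_extension_of_card_eq (by simp)
  exact ⟨b, hb 0 rfl⟩

end HardInstance

end LinBandit

theorem mainTheorem3_general (d T : ℕ) (hT : 0 < T) (ρ Δ : ℝ) (hρ : 0 < ρ) (hΔ_nonneg : 0 ≤ Δ)
    (hΔ : 2 * √(T : ℝ) * Δ ^ 2 ≤ ρ * d)
    (h : EuclideanSpace ℝ (Fin (d + 1))) (hh : ‖h‖ = 1)
    (alg : LinBandit.Algorithm (d + 1)) :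
    ∃ B : LinBandit.Instance (d + 1),
      (∀ t, B.noise t = gaussianReal 0 1) ∧
      ‖B.θ - ρ • h‖ = Δ ∧
      ‖B.optAction - h‖ ≤ Δ / ρ ∧
      B.instRegret B.optAction h = √(ρ ^ 2 + Δ ^ 2) - ρ ∧
      T * B.instRegret B.optAction h ≤ LinBandit.expectedRegret alg B T := by
  obtain ⟨b, rfl⟩ := LinBandit.exists_orthonormalBasis_zero_eq hh
  obtain ⟨w, hw, hregret⟩ := LinBandit.exists_perturbation_le_expectedRegret b alg hT hρ hΔ
  have hgap := LinBandit.instRegret_optAction_gaussianInstance_perturbedHint b (ρ := ρ) w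
  have hdist := LinBandit.norm_perturbedHint_sub b ρ w
  have hopt := LinBandit.norm_optAction_gaussianInstance_perturbedHint_sub_le b w hρ
  rw [hw, Real.sqrt_sq hΔ_nonneg] at hdist hopt
  refine ⟨LinBandit.gaussianInstance (LinBandit.perturbedHint b ρ w), fun _ => rfl, hdist, hopt,
    ?_, hgap.symm ▸ hregret⟩
  rw [hgap, LinBandit.norm_perturbedHint, hw]

theorem mainTheorem3 (d T : ℕ) (hT : max ((d : ℝ) ^ 2 / 2 ^ 8) (2 ^ 6) ≤ (T : ℝ))
    (Δ : ℝ) (hΔ_nonneg : 0 ≤ Δ) (hΔ : Δ ^ 2 = (d : ℝ) / (2 ^ 8 * Real.sqrt (T : ℝ)))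
    (h : EuclideanSpace ℝ (Fin (d + 1))) (hh : ‖h‖ = 1)
    (alg : LinBandit.Algorithm (d + 1)) :
    ∃ B : LinBandit.Instance (d + 1),
      (∀ t, B.noise t = ProbabilityTheory.gaussianReal 0 1) ∧
      ‖B.θ - (1 / 2 : ℝ) • h‖ ≤ Δ ∧
      ‖B.optAction - h‖ ≤ 4 * Δ ∧
      B.instRegret B.optAction h ≤ 972 * Δ ^ 2 ∧
      972 * Δ ^ 2 = 243 / 64 * ((d : ℝ) / Real.sqrt (T : ℝ)) ∧
      (d : ℝ) * Real.sqrt (T : ℝ) / 512 ≤ LinBandit.expectedRegret alg B T := by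
  have hT_pos : 0 < (T : ℝ) := lt_of_lt_of_le (by norm_num) ((le_max_right _ _).trans hT)
  have hd : d = 2 ^ 8 * √(T : ℝ) * Δ ^ 2 := by
    rw [hΔ]
    field_simp
  have hd_le : (d : ℝ) / 2 ^ 4 ≤ √T :=
    Real.le_sqrt_of_sq_le (by linarith [(le_max_left _ _).trans hT])
  have hΔ_le : Δ ^ 2 ≤ 2 :=
    hΔ ▸ div_le_of_le_mul₀ (by positivity) zero_le_two (by linarith [Real.sqrt_nonneg (T : ℝ)])
  have hgap_lower := LinBandit.le_sqrt_sq_add_sub one_half_pos (sq_nonneg Δ) (by linarith)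
  have hgap_upper := LinBandit.sqrt_sq_add_sub_le one_half_pos (sq_nonneg Δ)
  obtain ⟨B, hnoise, hθ, hopt, hgap, hregret⟩ := mainTheorem3_general d T (Nat.cast_pos.mp hT_pos)
    (1 / 2) Δ one_half_pos hΔ_nonneg (by linarith) h hh alg
  refine ⟨B, hnoise, hθ.le, by linarith, by linarith [sq_nonneg Δ], by rw [hΔ]; ring, ?_⟩
  calc (d : ℝ) * √T / 512 = √T ^ 2 * (Δ ^ 2 / 2) := by rw [hd]; ring
    _ ≤ T * B.instRegret B.optAction h := by
      rw [Real.sq_sqrt hT_pos.le, hgap]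
      gcongr
      linarith
    _ ≤ LinBandit.expectedRegret alg B T := hregret
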